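/- Let $d\in\{2,3\}$, let $D\subset\mathbb{R}^d$ be a bounded open set (for instance a bounded domain with piecewise smooth boundary), let $A,A_1,\dots,A_M$ be constant real symmetric $d\times d$ matrices, let $z_1,\dots,z_M\in D$ be distinct points and let $B_1,\dots,B_M\subset\mathbb{R}^d$ be bounded measurable sets (for instance smooth deformations of balls centered at the origin). For $\varepsilon>0$ put $A_\varepsilon=A_m$ on $z_m+\varepsilon B_m$ for $m=1,\dots,M$ and $A_\varepsilon=A$ elsewhere; this is well defined whenever the sets $z_m+\varepsilon B_m$ are pairwise disjoint, hence for all small $\varepsilon$. Put $A_0=A$. Write $$A_{\min}=\inf_{|\xi|=1}\overline{\xi}\cdot A\xi,\quad A_{\max}=\sup_{|\xi|=1}\overline{\xi}\cdot A\xi,\quad a_{\min}=\min_m\inf_{|\xi|=1}\overline{\xi}\cdot A_m\xi,\quad a_{\max}=\max_m\sup_{|\xi|=1}\overline{\xi}\cdot A_m\xi ,$$ and assume that either (i) $A_{\min}>1$ and $a_{\min}>1$, in which case let $\gamma=A_{\min}$, or (ii) $A_{\min}>0$, $a_{\min}>0$, $A_{\max}<1$ and $a_{\max}<1$, in which case let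 $\gamma=A_{\max}$ (the conditions on $a_{\min},a_{\max}$ being void if $M=0$). Let $X(D)=\{(w,v)\in H^1(D)\times H^1(D): w-v\in H^1_0(D)\}$ (complex-valued functions) with the inner product of $H^1(D)\times H^1(D)$, and let $\mathbf{A}_\varepsilon:X(D)\to X(D)$ be the bounded operator that represents, by the Riesz theorem, the sesquilinear form $$\mathcal{A}_\varepsilon\big((w,v);(\varphi_1,\varphi_2)\big)=\int_D A_\varepsilon\nabla w\cdot\nabla\overline{\varphi}_1+\gamma\, w\,\overline{\varphi}_1\,dx-\int_D\nabla v\cdot\nabla\overline{\varphi}_2+v\,\overline{\varphi}_2\,dx ,$$ that is, $\big(\mathbf{A}_\varepsilon(w,v),(\varphi_1,\varphi_2)\big)_{X(D)}=\mathcal{A}_\varepsilon\big((w,v);(\varphi_1,\varphi_2)\big)$. Then $\mathbf{A}_0$ is invertible, and $\mathbf{A}_\varepsilon$ is invertible for every $\varepsilon>0$ for which the sets $z_m+\varepsilon B_m$ are pairwise disjoint. Moreover, if $(f,g)\in X(D)$, $(w_\varepsilon,v_\varepsilon)=\mathbf{A}_\varepsilon^{-1}(f,g)$ and $(w,v)=\mathbf{A}_0^{-1}(f,g)$,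 and if $w$ is a smooth ($C^\infty$) function in $D$, then $$\|w_\varepsilon-w\|_{H^1(D)}+\|v_\varepsilon-v\|_{H^1(D)}=\mathcal{O}(\varepsilon^{d/2})\qquad\text{as }\varepsilon\to0^+ .$$ -/

import Mathlib

open MeasureTheory Filter Topology TopologicalSpace
open scoped ENNReal Pointwise ContDiff Distributions InnerProductSpace

noncomputable section

namespace TransmissionDefect

/-! ### Sobolev spaces on an open set `D ⊆ ℝ^d`, complex valued -/

/-- The space `L²(D; ℂ)`. -/
abbrev L2 {d : ℕ} (D : Opens (EuclideanSpace ℝ (Fin d))) : Type :=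
  Lp ℂ 2 (volume.restrict (D : Set (EuclideanSpace ℝ (Fin d))))

/-- The space `L²(D; ℂ^d)` of square integrable vector fields. -/
abbrev L2Vec {d : ℕ} (D : Opens (EuclideanSpace ℝ (Fin d))) : Type :=
  Lp (EuclideanSpace ℂ (Fin d)) 2 (volume.restrict (D : Set (EuclideanSpace ℝ (Fin d))))

/-- `G` is the weak gradient of `u` in `D`:
`∫_D u ∂ᵢφ = - ∫_D Gᵢ φ` for all test functions `φ ∈ C_c^∞(D)` and all `i`. -/
def IsWeakGradient {d : ℕ} (D : Opens (EuclideanSpace ℝ (Fin d))) (u : L2 D) (G : L2Vec D) :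
    Prop :=
  ∀ (φ : 𝓓(D, ℂ)) (i : Fin d),
    ∫ x in (D : Set (EuclideanSpace ℝ (Fin d))),
        u x * fderiv ℝ φ x (EuclideanSpace.single i (1 : ℝ)) =
      - ∫ x in (D : Set (EuclideanSpace ℝ (Fin d))), G x i * φ x

section Aux

variable {d : ℕ} {D : Opens (EuclideanSpace ℝ (Fin d))}

theorem memLp_test (φ : 𝓓(D, ℂ)) :
    MemLp (fun x => φ x) 2 (volume.restrict (D : Set (EuclideanSpace ℝ (Fin d)))) :=
  (φ.continuous.memLp_of_hasCompactSupport φ.hasCompactSupport).restrict _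

theorem memLp_test_fderiv (φ : 𝓓(D, ℂ)) (i : Fin d) :
    MemLp (fun x => fderiv ℝ φ x (EuclideanSpace.single i (1 : ℝ))) 2
      (volume.restrict (D : Set (EuclideanSpace ℝ (Fin d)))) := by
  refine MemLp.restrict _ (Continuous.memLp_of_hasCompactSupport ?_ ?_)
  · exact (φ.contDiff.continuous_fderiv (by simp)).clm_apply continuous_const
  · exact φ.hasCompactSupport.fderiv_apply (𝕜 := ℝ) _

theorem integrable_left (u : L2 D) (φ : 𝓓(D, ℂ)) (i : Fin d) :
    Integrable (fun x => u x * fderiv ℝ φ x (EuclideanSpace.single i (1 : ℝ)))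
      (volume.restrict (D : Set (EuclideanSpace ℝ (Fin d)))) :=
  (Lp.memLp u).integrable_mul (memLp_test_fderiv φ i)

theorem memLp_coord (G : L2Vec D) (i : Fin d) :
    MemLp (fun x => G x i) 2 (volume.restrict (D : Set (EuclideanSpace ℝ (Fin d)))) :=
  (EuclideanSpace.proj (𝕜 := ℂ) i).comp_memLp' (Lp.memLp G)

theorem integrable_right (G : L2Vec D) (φ : 𝓓(D, ℂ)) (i : Fin d) :
    Integrable (fun x => G x i * φ x)
      (volume.restrict (D : Set (EuclideanSpace ℝ (Fin d)))) :=
  (memLp_coord G i).integrable_mul (memLp_test φ)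

theorem continuous_left (φ : 𝓓(D, ℂ)) (i : Fin d) :
    Continuous fun u : L2 D => ∫ x in (D : Set (EuclideanSpace ℝ (Fin d))),
      u x * fderiv ℝ φ x (EuclideanSpace.single i (1 : ℝ)) := by
  have h := (memLp_test_fderiv φ i).star
  have : (fun u : L2 D => ∫ x in (D : Set (EuclideanSpace ℝ (Fin d))),
      u x * fderiv ℝ φ x (EuclideanSpace.single i (1 : ℝ))) = fun u => ⟪h.toLp _, u⟫_ℂ := by
    funext u
    rw [L2.inner_def]
    refine integral_congr_ae ?_
    filter_upwards [h.coeFn_toLp] with x hx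
    simp [hx]
  rw [this]
  fun_prop

theorem continuous_right (φ : 𝓓(D, ℂ)) (i : Fin d) :
    Continuous fun G : L2Vec D => ∫ x in (D : Set (EuclideanSpace ℝ (Fin d))),
      G x i * φ x := by
  have h := (memLp_test φ).star
  have : (fun G : L2Vec D => ∫ x in (D : Set (EuclideanSpace ℝ (Fin d))), G x i * φ x) =
      fun G => ⟪h.toLp _, (EuclideanSpace.proj (𝕜 := ℂ) i).compLp G⟫_ℂ := by
    funext u
    rw [L2.inner_def]
    refine integral_congr_ae ?_
    filter_upwards [h.coeFn_toLp, (EuclideanSpace.proj (𝕜 := ℂ) i).coeFn_compLp u] with x hx hx'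
    simp [hx, hx']
  rw [this]
  have := ((EuclideanSpace.proj (𝕜 := ℂ) i).compLpL 2
    (volume.restrict (D : Set (EuclideanSpace ℝ (Fin d))))).continuous
  exact continuous_const.inner this

end Aux

/-- The Sobolev space `H¹(D)` as a subspace of a product: the pairs `(u, ∇u)` in `L²(D; ℂ) × L²(D; ℂ^d)` whose second
component is the weak gradient of the first one, with the inner product
`(u, v) = ∫_D u v̄ + ∇u · ∇v̄` inherited from the product. -/
def H1Sub {d : ℕ} (D : Opens (EuclideanSpace ℝ (Fin d))) :
    Submodule ℂ (WithLp 2 (L2 D × L2Vec D)) where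
  carrier := {U | IsWeakGradient D U.fst U.snd}
  zero_mem' := by
    intro φ i
    have h1 : (fun x => ((0 : L2 D) x) * fderiv ℝ φ x (EuclideanSpace.single i (1 : ℝ)))
        =ᵐ[volume.restrict (D : Set (EuclideanSpace ℝ (Fin d)))] fun _ => 0 := by
      filter_upwards [Lp.coeFn_zero ℂ 2
        (volume.restrict (D : Set (EuclideanSpace ℝ (Fin d))))] with x hx
      rw [hx]
      simp
    have h2 : (fun x => ((0 : L2Vec D) x) i * φ x)
        =ᵐ[volume.restrict (D : Set (EuclideanSpace ℝ (Fin d)))] fun _ => 0 := by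
      filter_upwards [Lp.coeFn_zero (EuclideanSpace ℂ (Fin d)) 2
        (volume.restrict (D : Set (EuclideanSpace ℝ (Fin d))))] with x hx
      rw [hx]
      simp
    simp only [WithLp.zero_fst, WithLp.zero_snd]
    rw [integral_congr_ae h1, integral_congr_ae h2]
    simp
  add_mem' := by
    intro U V hU hV φ i
    have h1 : (fun x => ((U.fst + V.fst : L2 D) x) *
          fderiv ℝ φ x (EuclideanSpace.single i (1 : ℝ)))
        =ᵐ[volume.restrict (D : Set (EuclideanSpace ℝ (Fin d)))]
        fun x => U.fst x * fderiv ℝ φ x (EuclideanSpace.single i (1 : ℝ)) +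
          V.fst x * fderiv ℝ φ x (EuclideanSpace.single i (1 : ℝ)) := by
      filter_upwards [Lp.coeFn_add U.fst V.fst] with x hx
      rw [hx]
      simp [add_mul]
    have h2 : (fun x => ((U.snd + V.snd : L2Vec D) x) i * φ x)
        =ᵐ[volume.restrict (D : Set (EuclideanSpace ℝ (Fin d)))]
        fun x => U.snd x i * φ x + V.snd x i * φ x := by
      filter_upwards [Lp.coeFn_add U.snd V.snd] with x hx
      rw [hx]
      simp [add_mul]
    simp only [WithLp.add_fst, WithLp.add_snd]
    rw [integral_congr_ae h1, integral_congr_ae h2,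
      integral_add (integrable_left _ φ i) (integrable_left _ φ i),
      integral_add (integrable_right _ φ i) (integrable_right _ φ i), hU φ i, hV φ i]
    ring
  smul_mem' := by
    intro c U hU φ i
    have h1 : (fun x => ((c • U.fst : L2 D) x) *
          fderiv ℝ φ x (EuclideanSpace.single i (1 : ℝ)))
        =ᵐ[volume.restrict (D : Set (EuclideanSpace ℝ (Fin d)))]
        fun x => c * (U.fst x * fderiv ℝ φ x (EuclideanSpace.single i (1 : ℝ))) := by
      filter_upwards [Lp.coeFn_smul c U.fst] with x hx
      rw [hx]
      simp [mul_assoc]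
    have h2 : (fun x => ((c • U.snd : L2Vec D) x) i * φ x)
        =ᵐ[volume.restrict (D : Set (EuclideanSpace ℝ (Fin d)))]
        fun x => c * (U.snd x i * φ x) := by
      filter_upwards [Lp.coeFn_smul c U.snd] with x hx
      rw [hx]
      simp [mul_assoc]
    simp only [WithLp.smul_fst, WithLp.smul_snd]
    rw [integral_congr_ae h1, integral_congr_ae h2, integral_const_mul, integral_const_mul,
      hU φ i]
    ring

theorem isClosed_H1Sub {d : ℕ} (D : Opens (EuclideanSpace ℝ (Fin d))) :
    IsClosed (H1Sub D : Set (WithLp 2 (L2 D × L2Vec D))) := by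
  have : (H1Sub D : Set (WithLp 2 (L2 D × L2Vec D))) = ⋂ (φ : 𝓓(D, ℂ)) (i : Fin d),
      {U | ∫ x in (D : Set (EuclideanSpace ℝ (Fin d))),
          U.fst x * fderiv ℝ φ x (EuclideanSpace.single i (1 : ℝ)) =
        - ∫ x in (D : Set (EuclideanSpace ℝ (Fin d))), U.snd x i * φ x} := by
    ext U
    simp only [Set.mem_iInter, Set.mem_ofPred_eq]
    rfl
  rw [this]
  refine isClosed_iInter fun φ => isClosed_iInter fun i => ?_
  refine isClosed_eq ?_ ?_
  · exact (continuous_left φ i).comp (WithLp.fstL 2 ℂ (L2 D) (L2Vec D)).continuous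
  · exact ((continuous_right φ i).comp (WithLp.sndL 2 ℂ (L2 D) (L2Vec D)).continuous).neg

/-- The Hilbert space `H¹(D)`. -/
def H1 {d : ℕ} (D : Opens (EuclideanSpace ℝ (Fin d))) : Type := H1Sub D

instance {d : ℕ} (D : Opens (EuclideanSpace ℝ (Fin d))) : NormedAddCommGroup (H1 D) :=
  inferInstanceAs (NormedAddCommGroup (H1Sub D))

instance {d : ℕ} (D : Opens (EuclideanSpace ℝ (Fin d))) : InnerProductSpace ℂ (H1 D) :=
  inferInstanceAs (InnerProductSpace ℂ (H1Sub D))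

instance {d : ℕ} (D : Opens (EuclideanSpace ℝ (Fin d))) : CompleteSpace (H1 D) :=
  (isClosed_H1Sub D).completeSpace_coe

/-- The inclusion of `H¹(D)` into `L²(D; ℂ) × L²(D; ℂ^d)`, `u ↦ (u, ∇u)`. -/
def H1.incl {d : ℕ} (D : Opens (EuclideanSpace ℝ (Fin d))) :
    H1 D →L[ℂ] WithLp 2 (L2 D × L2Vec D) :=
  (H1Sub D).subtypeL

/-- The function underlying an element of `H¹(D)`, as a bounded linear map into `L²(D)`. -/
def fn {d : ℕ} (D : Opens (EuclideanSpace ℝ (Fin d))) : H1 D →L[ℂ] L2 D :=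
  (WithLp.fstL 2 ℂ (L2 D) (L2Vec D)).comp (H1.incl D)

/-- The weak gradient on `H¹(D)`, as a bounded linear map into `L²(D; ℂ^d)`. -/
def grad {d : ℕ} (D : Opens (EuclideanSpace ℝ (Fin d))) : H1 D →L[ℂ] L2Vec D :=
  (WithLp.sndL 2 ℂ (L2 D) (L2Vec D)).comp (H1.incl D)

/-- The elements of `H¹(D)` that are represented by a test function in `C_c^∞(D)`. -/
def testSubmodule {d : ℕ} (D : Opens (EuclideanSpace ℝ (Fin d))) : Submodule ℂ (H1 D) where
  carrier := {u | ∃ φ : 𝓓(D, ℂ),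
    (fn D u : EuclideanSpace ℝ (Fin d) → ℂ)
      =ᵐ[volume.restrict (D : Set (EuclideanSpace ℝ (Fin d)))] φ}
  zero_mem' := by
    refine ⟨0, ?_⟩
    rw [map_zero]
    filter_upwards [Lp.coeFn_zero ℂ 2
      (volume.restrict (D : Set (EuclideanSpace ℝ (Fin d))))] with x hx
    rw [hx]
    simp
  add_mem' := by
    rintro u v ⟨φ, hφ⟩ ⟨ψ, hψ⟩
    refine ⟨φ + ψ, ?_⟩
    rw [map_add]
    filter_upwards [Lp.coeFn_add (fn D u) (fn D v), hφ, hψ] with x hx h1 h2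
    rw [hx, Pi.add_apply, h1, h2]
    simp
  smul_mem' := by
    rintro c u ⟨φ, hφ⟩
    refine ⟨c • φ, ?_⟩
    rw [map_smul]
    filter_upwards [Lp.coeFn_smul c (fn D u), hφ] with x hx h1
    rw [hx, Pi.smul_apply, h1]
    simp

/-- The space `H¹₀(D)`, the closure of `C_c^∞(D)` in `H¹(D)`. -/
def H10 {d : ℕ} (D : Opens (EuclideanSpace ℝ (Fin d))) : Submodule ℂ (H1 D) :=
  (testSubmodule D).topologicalClosure

/-- The subspace `X(D) = {(w, v) ∈ H¹(D) × H¹(D) : w - v ∈ H¹₀(D)}` with the inner product of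
`H¹(D) × H¹(D)`. -/
def XSub {d : ℕ} (D : Opens (EuclideanSpace ℝ (Fin d))) :
    Submodule ℂ (WithLp 2 (H1 D × H1 D)) where
  carrier := {U | U.fst - U.snd ∈ H10 D}
  zero_mem' := by simp
  add_mem' := by
    intro U V hU hV
    have := (H10 D).add_mem hU hV
    simp only [Set.mem_ofPred_eq, WithLp.add_fst, WithLp.add_snd]
    rwa [add_sub_add_comm]
  smul_mem' := by
    intro c U hU
    have := (H10 D).smul_mem c hU
    simp only [Set.mem_ofPred_eq, WithLp.smul_fst, WithLp.smul_snd]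
    rwa [← smul_sub]

theorem isClosed_XSub {d : ℕ} (D : Opens (EuclideanSpace ℝ (Fin d))) :
    IsClosed (XSub D : Set (WithLp 2 (H1 D × H1 D))) := by
  have h : IsClosed (H10 D : Set (H1 D)) := (testSubmodule D).isClosed_topologicalClosure
  exact h.preimage (((WithLp.fstL 2 ℂ (H1 D) (H1 D)).continuous).sub
    ((WithLp.sndL 2 ℂ (H1 D) (H1 D)).continuous))

/-- The Hilbert space `X(D)`. -/
def X {d : ℕ} (D : Opens (EuclideanSpace ℝ (Fin d))) : Type := XSub D

instance {d : ℕ} (D : Opens (EuclideanSpace ℝ (Fin d))) : NormedAddCommGroup (X D) :=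
  inferInstanceAs (NormedAddCommGroup (XSub D))

instance {d : ℕ} (D : Opens (EuclideanSpace ℝ (Fin d))) : InnerProductSpace ℂ (X D) :=
  inferInstanceAs (InnerProductSpace ℂ (XSub D))

instance {d : ℕ} (D : Opens (EuclideanSpace ℝ (Fin d))) : CompleteSpace (X D) :=
  (isClosed_XSub D).completeSpace_coe

/-- The inclusion of `X(D)` into `H¹(D) × H¹(D)`. -/
def X.incl {d : ℕ} (D : Opens (EuclideanSpace ℝ (Fin d))) : X D →L[ℂ] WithLp 2 (H1 D × H1 D) :=
  (XSub D).subtypeL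

/-- The first component `w` of `(w, v) ∈ X(D)`. -/
def wPart {d : ℕ} (D : Opens (EuclideanSpace ℝ (Fin d))) : X D →L[ℂ] H1 D :=
  (WithLp.fstL 2 ℂ (H1 D) (H1 D)).comp (X.incl D)

/-- The second component `v` of `(w, v) ∈ X(D)`. -/
def vPart {d : ℕ} (D : Opens (EuclideanSpace ℝ (Fin d))) : X D →L[ℂ] H1 D :=
  (WithLp.sndL 2 ℂ (H1 D) (H1 D)).comp (X.incl D)

/-! ### Coefficients -/

/-- The action of a real `d × d` matrix on `ℂ^d`. -/
def matAct {d : ℕ} (a : Matrix (Fin d) (Fin d) ℝ) :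
    EuclideanSpace ℂ (Fin d) →L[ℂ] EuclideanSpace ℂ (Fin d) :=
  Matrix.toEuclideanCLM (n := Fin d) (𝕜 := ℂ) (a.map (fun t : ℝ => (t : ℂ)))

/-- `inf_{|ξ| = 1} ξ̄ · a ξ` over complex unit vectors `ξ` (a real number if `a` is symmetric). -/
def quadMin {d : ℕ} (a : Matrix (Fin d) (Fin d) ℝ) : ℝ :=
  ⨅ ξ : Metric.sphere (0 : EuclideanSpace ℂ (Fin d)) 1,
    (⟪(ξ : EuclideanSpace ℂ (Fin d)), matAct a ξ⟫_ℂ).re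

/-- `sup_{|ξ| = 1} ξ̄ · a ξ` over complex unit vectors `ξ` (a real number if `a` is symmetric). -/
def quadMax {d : ℕ} (a : Matrix (Fin d) (Fin d) ℝ) : ℝ :=
  ⨆ ξ : Metric.sphere (0 : EuclideanSpace ℂ (Fin d)) 1,
    (⟪(ξ : EuclideanSpace ℂ (Fin d)), matAct a ξ⟫_ℂ).re

/-- Bounded measurable real matrix fields on `ℝ^d`. -/
structure Coeff (d : ℕ) where
  toFun : EuclideanSpace ℝ (Fin d) → Matrix (Fin d) (Fin d) ℝ
  measurable_entry : ∀ i j, Measurable fun x => toFun x i j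
  bounded_entry : ∃ C : ℝ, ∀ x i j, |toFun x i j| ≤ C

/-- The constant matrix field `A`. -/
def constCoeff {d : ℕ} (A : Matrix (Fin d) (Fin d) ℝ) : Coeff d where
  toFun := fun _ => A
  measurable_entry := fun _ _ => measurable_const
  bounded_entry := by
    refine ⟨∑ i, ∑ j, |A i j|, fun _ i j => ?_⟩
    exact (Finset.single_le_sum (f := fun j => |A i j|) (fun _ _ => abs_nonneg _)
      (Finset.mem_univ j)).trans (Finset.single_le_sum (f := fun i => ∑ j, |A i j|)
      (fun _ _ => Finset.sum_nonneg fun _ _ => abs_nonneg _) (Finset.mem_univ i))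

/-- The defective region `z + ε B`. -/
def region {d : ℕ} (z : EuclideanSpace ℝ (Fin d)) (B : Set (EuclideanSpace ℝ (Fin d))) (ε : ℝ) :
    Set (EuclideanSpace ℝ (Fin d)) :=
  (fun y => z + ε • y) '' B

theorem measurableSet_region {d : ℕ} (z : EuclideanSpace ℝ (Fin d))
    {B : Set (EuclideanSpace ℝ (Fin d))} (hB : MeasurableSet B) (ε : ℝ) :
    MeasurableSet (region z B ε) := by
  rcases eq_or_ne ε 0 with rfl | hε
  · refine Set.Subsingleton.measurableSet ?_
    rintro _ ⟨x, _, rfl⟩ _ ⟨y, _, rfl⟩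
    simp
  · exact ((Homeomorph.smulOfNeZero ε hε).trans
      (Homeomorph.addLeft z)).measurableEmbedding.measurableSet_image' hB

open Classical in
/-- The perturbed matrix field `A_ε`, written as `A + ∑ₘ 1_{zₘ + ε Bₘ} (Aₘ - A)`. When the regions
`zₘ + ε Bₘ` are pairwise disjoint, it equals `Aₘ` on `zₘ + ε Bₘ` and `A` elsewhere. -/
def defectCoeff {d M : ℕ} (A : Matrix (Fin d) (Fin d) ℝ)
    (Am : Fin M → Matrix (Fin d) (Fin d) ℝ) (z : Fin M → EuclideanSpace ℝ (Fin d))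
    (B : Fin M → Set (EuclideanSpace ℝ (Fin d))) (hB : ∀ m, MeasurableSet (B m)) (ε : ℝ) :
    Coeff d where
  toFun := fun x => A + ∑ m, if x ∈ region (z m) (B m) ε then Am m - A else 0
  measurable_entry := by
    intro i j
    simp only [Matrix.add_apply, Matrix.sum_apply]
    refine measurable_const.add (Finset.measurable_fun_sum _ fun m _ => ?_)
    simp only [apply_ite (fun a : Matrix (Fin d) (Fin d) ℝ => a i j)]
    exact Measurable.ite (measurableSet_region _ (hB m) ε) measurable_const measurable_const
  bounded_entry := by
    refine ⟨(∑ i, ∑ j, |A i j|) + ∑ m, ∑ i, ∑ j, |(Am m - A) i j|, fun x i j => ?_⟩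
    have key : ∀ a : Matrix (Fin d) (Fin d) ℝ, |a i j| ≤ ∑ i, ∑ j, |a i j| := fun a =>
      (Finset.single_le_sum (f := fun j => |a i j|) (fun _ _ => abs_nonneg _)
        (Finset.mem_univ j)).trans (Finset.single_le_sum (f := fun i => ∑ j, |a i j|)
        (fun _ _ => Finset.sum_nonneg fun _ _ => abs_nonneg _) (Finset.mem_univ i))
    simp only [Matrix.add_apply, Matrix.sum_apply]
    refine (abs_add_le _ _).trans (add_le_add (key A) ?_)
    refine (Finset.abs_sum_le_sum_abs _ _).trans (Finset.sum_le_sum fun m _ => ?_)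
    split_ifs
    · exact key _
    · simpa using Finset.sum_nonneg fun i _ => Finset.sum_nonneg fun j _ => abs_nonneg _

theorem defectCoeff_of_mem {d M : ℕ} (A : Matrix (Fin d) (Fin d) ℝ)
    (Am : Fin M → Matrix (Fin d) (Fin d) ℝ) (z : Fin M → EuclideanSpace ℝ (Fin d))
    (B : Fin M → Set (EuclideanSpace ℝ (Fin d))) (hB : ∀ m, MeasurableSet (B m)) (ε : ℝ)
    (hd : Pairwise fun i j => Disjoint (region (z i) (B i) ε) (region (z j) (B j) ε))
    (m : Fin M) {x : EuclideanSpace ℝ (Fin d)} (hx : x ∈ region (z m) (B m) ε) :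
    (defectCoeff A Am z B hB ε).toFun x = Am m := by
  have : ∀ k, k ≠ m → x ∉ region (z k) (B k) ε := fun k hk hx' =>
    Set.disjoint_left.1 (hd hk) hx' hx
  simp only [defectCoeff]
  rw [Finset.sum_eq_single m (fun k _ hk => if_neg (this k hk)) (by simp), if_pos hx]
  abel

theorem defectCoeff_of_notMem {d M : ℕ} (A : Matrix (Fin d) (Fin d) ℝ)
    (Am : Fin M → Matrix (Fin d) (Fin d) ℝ) (z : Fin M → EuclideanSpace ℝ (Fin d))
    (B : Fin M → Set (EuclideanSpace ℝ (Fin d))) (hB : ∀ m, MeasurableSet (B m)) (ε : ℝ)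
    {x : EuclideanSpace ℝ (Fin d)} (hx : ∀ m, x ∉ region (z m) (B m) ε) :
    (defectCoeff A Am z B hB ε).toFun x = A := by
  simp [defectCoeff, hx]

/-! ### The sesquilinear form and its operator -/

/-- The sesquilinear form
`𝒜((w, v); (φ₁, φ₂)) = ∫_D a ∇w · ∇φ̄₁ + γ w φ̄₁ dx - ∫_D ∇v · ∇φ̄₂ + v φ̄₂ dx`. -/
def form {d : ℕ} (D : Opens (EuclideanSpace ℝ (Fin d))) (a : Coeff d) (γ : ℝ) (U Φ : X D) : ℂ :=
  (∫ x in (D : Set (EuclideanSpace ℝ (Fin d))),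
      (⟪grad D (wPart D Φ) x, matAct (a.toFun x) (grad D (wPart D U) x)⟫_ℂ
        + (γ : ℂ) * ⟪fn D (wPart D Φ) x, fn D (wPart D U) x⟫_ℂ))
  - ∫ x in (D : Set (EuclideanSpace ℝ (Fin d))),
      (⟪grad D (vPart D Φ) x, grad D (vPart D U) x⟫_ℂ
        + ⟪fn D (vPart D Φ) x, fn D (vPart D U) x⟫_ℂ)

theorem matAct_eq_sum {d : ℕ} (a : Matrix (Fin d) (Fin d) ℝ) (ξ : EuclideanSpace ℂ (Fin d)) :
    matAct a ξ = ∑ i, ∑ j, (a i j : ℂ) • matAct (Matrix.single i j 1) ξ := by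
  ext k
  simp only [matAct, WithLp.ofLp_sum, WithLp.ofLp_smul, Matrix.ofLp_toEuclideanCLM,
    Finset.sum_apply, Pi.smul_apply]
  rw [Finset.sum_eq_single k]
  · simp only [Matrix.mulVec, dotProduct, Matrix.map_apply, smul_eq_mul]
    refine Finset.sum_congr rfl fun j _ => ?_
    rw [Finset.sum_eq_single j]
    · simp
    · intro b _ hb
      simp [hb.symm]
    · simp
  · intro i _ hi
    simp [Matrix.mulVec, dotProduct, hi]
  · simp

theorem exists_coeffMul {d : ℕ} (D : Opens (EuclideanSpace ℝ (Fin d))) (a : Coeff d) :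
    ∃ T : L2Vec D →L[ℂ] L2Vec D, ∀ G : L2Vec D,
      (T G : EuclideanSpace ℝ (Fin d) → EuclideanSpace ℂ (Fin d))
        =ᵐ[volume.restrict (D : Set (EuclideanSpace ℝ (Fin d)))]
          fun x => matAct (a.toFun x) (G x) := by
  obtain ⟨C, hC⟩ := a.bounded_entry
  set K : ℝ := ∑ i, ∑ j, C * ‖matAct (Matrix.single i j (1 : ℝ) : Matrix (Fin d) (Fin d) ℝ)‖
    with hK
  have hb : ∀ x (ξ : EuclideanSpace ℂ (Fin d)), ‖matAct (a.toFun x) ξ‖ ≤ K * ‖ξ‖ := by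
    intro x ξ
    rw [matAct_eq_sum, hK, Finset.sum_mul]
    refine (norm_sum_le _ _).trans (Finset.sum_le_sum fun i _ => ?_)
    rw [Finset.sum_mul]
    refine (norm_sum_le _ _).trans (Finset.sum_le_sum fun j _ => ?_)
    rw [norm_smul, mul_assoc]
    refine mul_le_mul ?_ (ContinuousLinearMap.le_opNorm _ _) (norm_nonneg _)
      ((abs_nonneg _).trans (hC x i j))
    simpa using hC x i j
  have hm : ∀ G : L2Vec D, AEStronglyMeasurable (fun x => matAct (a.toFun x) (G x))
      (volume.restrict (D : Set (EuclideanSpace ℝ (Fin d)))) := by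
    intro G
    have : (fun x => matAct (a.toFun x) (G x)) = fun x =>
        ∑ i, ∑ j, ((a.toFun x i j : ℝ) : ℂ) • matAct (Matrix.single i j 1) (G x) := by
      funext x
      exact matAct_eq_sum _ _
    rw [this]
    refine Finset.aestronglyMeasurable_fun_sum _ fun i _ =>
      Finset.aestronglyMeasurable_fun_sum _ fun j _ => ?_
    have h1 : AEStronglyMeasurable (fun x => ((a.toFun x i j : ℝ) : ℂ))
        (volume.restrict (D : Set (EuclideanSpace ℝ (Fin d)))) :=
      (Complex.measurable_ofReal.comp (a.measurable_entry i j)).aestronglyMeasurable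
    exact h1.smul ((matAct (Matrix.single i j 1)).continuous.comp_aestronglyMeasurable
      (Lp.memLp G).1)
  have hL : ∀ G : L2Vec D, MemLp (fun x => matAct (a.toFun x) (G x)) 2
      (volume.restrict (D : Set (EuclideanSpace ℝ (Fin d)))) := fun G =>
    (Lp.memLp G).of_le_mul (hm G) (Eventually.of_forall fun x => hb x _)
  let T₀ : L2Vec D →ₗ[ℂ] L2Vec D :=
    { toFun := fun G => (hL G).toLp _
      map_add' := by
        intro G H
        ext1
        filter_upwards [(hL (G + H)).coeFn_toLp, (hL G).coeFn_toLp, (hL H).coeFn_toLp,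
          Lp.coeFn_add G H, Lp.coeFn_add ((hL G).toLp _) ((hL H).toLp _)] with x h1 h2 h3 h4 h5
        rw [h1, h5, Pi.add_apply, h2, h3, h4, Pi.add_apply, map_add]
      map_smul' := by
        intro c G
        ext1
        filter_upwards [(hL (c • G)).coeFn_toLp, (hL G).coeFn_toLp,
          Lp.coeFn_smul c G, Lp.coeFn_smul c ((hL G).toLp _)] with x h1 h2 h3 h4
        simp only [RingHom.id_apply]
        rw [h1, h4, Pi.smul_apply, h2, h3, Pi.smul_apply, map_smul] }
  have hbd : ∀ G, ‖T₀ G‖ ≤ K * ‖G‖ := by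
    intro G
    refine Lp.norm_le_mul_norm_of_ae_le_mul ?_
    filter_upwards [(hL G).coeFn_toLp] with x hx
    change ‖((hL G).toLp _ : L2Vec D) x‖ ≤ _
    rw [hx]
    exact hb x _
  exact ⟨T₀.mkContinuous K hbd, fun G => (hL G).coeFn_toLp⟩

/-- The sesquilinear form is represented by a unique bounded operator on `X(D)`. -/
theorem existsUnique_op {d : ℕ} (D : Opens (EuclideanSpace ℝ (Fin d))) (a : Coeff d) (γ : ℝ) :
    ∃! T : X D →L[ℂ] X D, ∀ U Φ : X D, ⟪Φ, T U⟫_ℂ = form D a γ U Φ := by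
  obtain ⟨S, hS⟩ := exists_coeffMul D a
  let gw := (grad D).comp (wPart D)
  let fw := (fn D).comp (wPart D)
  let gv := (grad D).comp (vPart D)
  let fv := (fn D).comp (vPart D)
  have key : ∀ U Φ : X D, ⟪Φ, ((gw.adjoint.comp (S.comp gw) + (γ : ℂ) • fw.adjoint.comp fw)
      - (gv.adjoint.comp gv + fv.adjoint.comp fv)) U⟫_ℂ = form D a γ U Φ := by
    intro U Φ
    simp only [sub_apply, add_apply, smul_apply,
      ContinuousLinearMap.comp_apply, inner_sub_right, inner_add_right, inner_smul_right,
      ContinuousLinearMap.adjoint_inner_right]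
    rw [form, integral_add, integral_add, integral_const_mul]
    · simp only [L2.inner_def]
      congr 2
      refine integral_congr_ae ?_
      filter_upwards [hS (gw U)] with x hx
      exact congrArg (fun y => ⟪gw Φ x, y⟫_ℂ) hx
    · exact L2.integrable_inner (𝕜 := ℂ) (gv Φ) (gv U)
    · exact L2.integrable_inner (𝕜 := ℂ) (fv Φ) (fv U)
    · refine (L2.integrable_inner (𝕜 := ℂ) (gw Φ) (S (gw U))).congr ?_
      filter_upwards [hS (gw U)] with x hx
      exact congrArg (fun y => ⟪gw Φ x, y⟫_ℂ) hx
    · exact (L2.integrable_inner (𝕜 := ℂ) (fw Φ) (fw U)).const_mul _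
  refine ⟨_, key, fun T' hT' => ?_⟩
  ext1 U
  exact ext_inner_left ℂ fun Φ => (hT' U Φ).trans (key U Φ).symm

/-- The bounded operator `𝐀 : X(D) → X(D)` with `(𝐀 U, Φ)_{X(D)} = 𝒜(U; Φ)` for all `U, Φ`.
(Mathlib's inner product is antilinear in its first argument.) -/
def op {d : ℕ} (D : Opens (EuclideanSpace ℝ (Fin d))) (a : Coeff d) (γ : ℝ) : X D →L[ℂ] X D :=
  (existsUnique_op D a γ).choose

theorem inner_op {d : ℕ} (D : Opens (EuclideanSpace ℝ (Fin d))) (a : Coeff d) (γ : ℝ)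
    (U Φ : X D) : ⟪Φ, op D a γ U⟫_ℂ = form D a γ U Φ :=
  (existsUnique_op D a γ).choose_spec.1 U Φ

end TransmissionDefect

end

/-!
The form `𝒜_ε` is not coercive, but it is `T`-coercive: when all coefficients exceed `1`, testing
with `(w, 2w - v)` produces `⟪w, B w⟫ - 2 Re ⟪w, v⟫ + ‖v‖²`, where `B ≥ α > 1` represents the
`w`-part of the form, and Young's inequality absorbs the mixed term; when they lie between `0` and
`1`, testing with `(w - 2v, -v)` produces `⟪w, B w⟫ - 2 Re ⟪v, B w⟫ + ‖v‖²`, and Young's inequality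
for the form `B ≤ β < 1` does the same. The coercivity constant depends only on the finitely many
values of the coefficient, so the inverses of the operators `𝐀_ε` are bounded uniformly in `ε`.

The error solves `𝐀_ε (U_ε - U) = (𝐀₀ - 𝐀_ε) U`, and the right-hand side is bounded by the `L²`
norm of `(A_ε - A) ∇w`. This field is supported on the sets `z_m + ε B_m`, which have volume
`O(ε^d)` and close to which `∇w` is bounded, so that norm is `O(ε^{d/2})`.
-/

noncomputable section

namespace TransmissionDefect

section TCoercive

variable {𝕜 E : Type*} [RCLike 𝕜] [NormedAddCommGroup E] [InnerProductSpace 𝕜 E]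

/-- The operator `L` is `T`-coercive with constant `c`: the sesquilinear form `(u, v) ↦ ⟪v, L u⟫`
becomes coercive after its test functions are transformed by `T`. -/
def IsTCoercive (T L : E →L[𝕜] E) (c : ℝ) : Prop :=
  ∀ u, c * ‖u‖ ^ 2 ≤ RCLike.re ⟪T u, L u⟫_𝕜

variable {T L : E →L[𝕜] E} {c : ℝ}

theorem IsTCoercive.mul_norm_le (h : IsTCoercive T L c) (u : E) : c * ‖u‖ ≤ ‖T‖ * ‖L u‖ := by
  rcases eq_or_ne u 0 with rfl | hu
  · simp
  refine le_of_mul_le_mul_right ?_ (norm_pos_iff.2 hu)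
  calc c * ‖u‖ * ‖u‖ = c * ‖u‖ ^ 2 := by ring
    _ ≤ RCLike.re ⟪T u, L u⟫_𝕜 := h u
    _ ≤ ‖T u‖ * ‖L u‖ := re_inner_le_norm _ _
    _ ≤ ‖T‖ * ‖u‖ * ‖L u‖ := by gcongr; exact T.le_opNorm u
    _ = ‖T‖ * ‖L u‖ * ‖u‖ := by ring

theorem IsTCoercive.norm_sub_le (h : IsTCoercive T L c) (hc : 0 < c) {K : E →L[𝕜] E} {u v : E}
    (huv : L u = K v) : ‖u - v‖ ≤ ‖T‖ / c * ‖K v - L v‖ := by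
  rw [div_mul_eq_mul_div, le_div_iff₀' hc, ← huv, ← map_sub]
  exact h.mul_norm_le (u - v)

theorem IsTCoercive.isInvertible [CompleteSpace E] (h : IsTCoercive T L c) (hc : 0 < c)
    (hT : IsUnit T) : L.IsInvertible := by
  have hTL : IsUnit (star T * L) := by
    refine ContinuousLinearMap.isUnit_of_forall_le_norm_inner_map _ (Real.toNNReal_pos.2 hc)
      fun u => ?_
    rw [Real.coe_toNNReal _ hc.le, mul_comm, ← inner_conj_symm, RCLike.norm_conj,
      ContinuousLinearMap.star_eq_adjoint, mul_apply_eq_comp,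
      ContinuousLinearMap.adjoint_inner_right]
    exact (h u).trans (RCLike.re_le_norm _)
  obtain ⟨e, he⟩ := hT.star.mul_left_iff.1 hTL
  exact ⟨ContinuousLinearEquiv.ofUnit e, he⟩

variable {B : E →L[𝕜] E} {α β : ℝ}

theorem one_sub_inv_sqrt_mul_le_re_inner (hα : 1 ≤ α)
    (hB : ∀ w, α * ‖w‖ ^ 2 ≤ RCLike.re ⟪w, B w⟫_𝕜) (w v : E) :
    (1 - (√α)⁻¹) * (‖w‖ ^ 2 + ‖v‖ ^ 2) ≤
      RCLike.re (⟪w, B w⟫_𝕜 - ⟪(2 : 𝕜) • w - v, v⟫_𝕜) := by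
  have hs : 0 < √α := Real.sqrt_pos.2 (by linarith)
  have young : 2 * RCLike.re ⟪w, v⟫_𝕜 ≤ (√α)⁻¹ * (α * ‖w‖ ^ 2 + ‖v‖ ^ 2) := by
    have h := @norm_sub_sq 𝕜 _ _ _ _ ((√α : 𝕜) • w) v
    rw [inner_smul_left, RCLike.conj_ofReal, RCLike.re_ofReal_mul, norm_smul, RCLike.norm_ofReal,
      abs_of_pos hs, mul_pow, Real.sq_sqrt (by linarith)] at h
    rw [le_inv_mul_iff₀ hs]
    nlinarith [sq_nonneg ‖(√α : 𝕜) • w - v‖]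
  have hθ : (√α)⁻¹ ≤ 1 := inv_le_one_of_one_le₀ (Real.one_le_sqrt.2 hα)
  have expand : RCLike.re (⟪w, B w⟫_𝕜 - ⟪(2 : 𝕜) • w - v, v⟫_𝕜) =
      RCLike.re ⟪w, B w⟫_𝕜 - 2 * RCLike.re ⟪w, v⟫_𝕜 + ‖v‖ ^ 2 := by
    rw [two_smul, inner_sub_left, inner_add_left]
    simp only [map_sub, map_add, inner_self_eq_norm_sq]
    ring
  calc (1 - (√α)⁻¹) * (‖w‖ ^ 2 + ‖v‖ ^ 2)
      ≤ (1 - (√α)⁻¹) * (α * ‖w‖ ^ 2 + ‖v‖ ^ 2) := by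
        gcongr
        exact le_mul_of_one_le_left (sq_nonneg _) hα
    _ = α * ‖w‖ ^ 2 + ‖v‖ ^ 2 - (√α)⁻¹ * (α * ‖w‖ ^ 2 + ‖v‖ ^ 2) := by ring
    _ ≤ RCLike.re (⟪w, B w⟫_𝕜 - ⟪(2 : 𝕜) • w - v, v⟫_𝕜) := by linarith [hB w]

theorem one_sub_sqrt_mul_le_re_inner (hα : 0 ≤ α) (hβ : β ∈ Set.Ioc 0 1)
    (hB : (B : E →ₗ[𝕜] E).IsSymmetric) (hαB : ∀ u, α * ‖u‖ ^ 2 ≤ RCLike.re ⟪u, B u⟫_𝕜)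
    (hBβ : ∀ u, RCLike.re ⟪u, B u⟫_𝕜 ≤ β * ‖u‖ ^ 2) (w v : E) :
    (1 - √β) * α * (‖w‖ ^ 2 + ‖v‖ ^ 2) ≤
      RCLike.re (⟪w - (2 : 𝕜) • v, B w⟫_𝕜 - ⟪-v, v⟫_𝕜) := by
  have hs : 0 < √β := Real.sqrt_pos.2 hβ.1
  have hsβ : √β * √β = β := Real.mul_self_sqrt hβ.1.le
  have hs1 : √β ≤ 1 := Real.sqrt_le_one.2 hβ.2
  have young : 2 * RCLike.re ⟪v, B w⟫_𝕜 ≤ √β * (RCLike.re ⟪w, B w⟫_𝕜 + ‖v‖ ^ 2) := by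
    have hwv : RCLike.re ⟪w, B v⟫_𝕜 = RCLike.re ⟪v, B w⟫_𝕜 := by
      rw [← inner_re_symm]
      exact congrArg RCLike.re (hB v w)
    have h : 0 ≤ RCLike.re ⟪(√β : 𝕜) • w - v, B ((√β : 𝕜) • w - v)⟫_𝕜 :=
      (by positivity : (0 : ℝ) ≤ α * _ ^ 2).trans (hαB _)
    simp only [map_sub, map_smul, inner_sub_left, inner_sub_right, inner_smul_left,
      inner_smul_right, RCLike.conj_ofReal, RCLike.re_ofReal_mul, hwv] at h
    refine le_of_mul_le_mul_left ?_ hs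
    nlinarith [hBβ v]
  have expand : RCLike.re (⟪w - (2 : 𝕜) • v, B w⟫_𝕜 - ⟪-v, v⟫_𝕜) =
      RCLike.re ⟪w, B w⟫_𝕜 - 2 * RCLike.re ⟪v, B w⟫_𝕜 + ‖v‖ ^ 2 := by
    rw [two_smul, inner_sub_left, inner_add_left, inner_neg_left]
    simp only [map_sub, map_add, map_neg, inner_self_eq_norm_sq]
    ring
  have hv : α * ‖v‖ ^ 2 ≤ ‖v‖ ^ 2 :=
    ((hαB v).trans (hBβ v)).trans (mul_le_of_le_one_left (sq_nonneg _) hβ.2)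
  calc (1 - √β) * α * (‖w‖ ^ 2 + ‖v‖ ^ 2)
      = (1 - √β) * (α * ‖w‖ ^ 2 + α * ‖v‖ ^ 2) := by ring
    _ ≤ (1 - √β) * (RCLike.re ⟪w, B w⟫_𝕜 + ‖v‖ ^ 2) := by
        gcongr
        exact hαB w
    _ ≤ RCLike.re (⟪w - (2 : 𝕜) • v, B w⟫_𝕜 - ⟪-v, v⟫_𝕜) := by linarith

end TCoercive

section QuadraticForms

theorem re_inner_eq_rayleighQuotient_mul {𝕜 E : Type*} [RCLike 𝕜] [NormedAddCommGroup E]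
    [InnerProductSpace 𝕜 E] (T : E →L[𝕜] E) (x : E) :
    RCLike.re ⟪x, T x⟫_𝕜 = T.rayleighQuotient x * ‖x‖ ^ 2 := by
  rcases eq_or_ne x 0 with rfl | hx
  · simp
  · rw [ContinuousLinearMap.rayleighQuotient, T.reApplyInnerSelf_apply, inner_re_symm,
      div_mul_cancel₀ _ (by simpa using hx)]

variable {d : ℕ} (a : Matrix (Fin d) (Fin d) ℝ)

theorem quadMin_eq_iInf_rayleighQuotient :
    quadMin a = ⨅ ξ : {ξ : EuclideanSpace ℂ (Fin d) // ξ ≠ 0}, (matAct a).rayleighQuotient ξ := by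
  rw [(matAct a).iInf_rayleigh_eq_iInf_rayleigh_sphere one_pos]
  refine iInf_congr fun ξ => (re_inner_eq_rayleighQuotient_mul (matAct a) ξ).trans ?_
  simp

theorem quadMax_eq_iSup_rayleighQuotient :
    quadMax a = ⨆ ξ : {ξ : EuclideanSpace ℂ (Fin d) // ξ ≠ 0}, (matAct a).rayleighQuotient ξ := by
  rw [(matAct a).iSup_rayleigh_eq_iSup_rayleigh_sphere one_pos]
  refine iSup_congr fun ξ => (re_inner_eq_rayleighQuotient_mul (matAct a) ξ).trans ?_
  simp

theorem quadMin_mul_sq_le_re_inner (ξ : EuclideanSpace ℂ (Fin d)) :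
    quadMin a * ‖ξ‖ ^ 2 ≤ (⟪ξ, matAct a ξ⟫_ℂ).re := by
  rcases eq_or_ne ξ 0 with rfl | hξ
  · simp
  refine le_of_le_of_eq ?_ (re_inner_eq_rayleighQuotient_mul (matAct a) ξ).symm
  gcongr
  rw [quadMin_eq_iInf_rayleighQuotient]
  refine ciInf_le ⟨-‖matAct a‖, ?_⟩ (⟨ξ, hξ⟩ : {ξ : EuclideanSpace ℂ (Fin d) // ξ ≠ 0})
  rintro _ ⟨η, rfl⟩
  exact neg_le_of_abs_le ((matAct a).rayleighQuotient_le_norm η)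

theorem re_inner_le_quadMax_mul_sq (ξ : EuclideanSpace ℂ (Fin d)) :
    (⟪ξ, matAct a ξ⟫_ℂ).re ≤ quadMax a * ‖ξ‖ ^ 2 := by
  rcases eq_or_ne ξ 0 with rfl | hξ
  · simp
  refine (re_inner_eq_rayleighQuotient_mul (matAct a) ξ).trans_le ?_
  gcongr
  rw [quadMax_eq_iSup_rayleighQuotient]
  refine le_ciSup (f := fun η : {η : EuclideanSpace ℂ (Fin d) // η ≠ 0} =>
    (matAct a).rayleighQuotient η) ⟨‖matAct a‖, ?_⟩ ⟨ξ, hξ⟩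
  rintro _ ⟨η, rfl⟩
  exact le_of_abs_le ((matAct a).rayleighQuotient_le_norm η)

theorem quadMin_le_quadMax : quadMin a ≤ quadMax a := by
  rcases subsingleton_or_nontrivial (EuclideanSpace ℂ (Fin d)) with h | h
  · simp [quadMin, quadMax]
  · obtain ⟨ξ, hξ⟩ := exists_ne (0 : EuclideanSpace ℂ (Fin d))
    exact le_of_mul_le_mul_right
      ((quadMin_mul_sq_le_re_inner a ξ).trans (re_inner_le_quadMax_mul_sq a ξ)) (by positivity)

variable {a} in
theorem isSymmetric_matAct (ha : a.IsSymm) :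
    (matAct a : EuclideanSpace ℂ (Fin d) →ₗ[ℂ] EuclideanSpace ℂ (Fin d)).IsSymmetric := by
  have hstar : star (a.map (fun t : ℝ => (t : ℂ))) = a.map (fun t : ℝ => (t : ℂ)) := by
    ext i j
    simp [Matrix.star_apply, ha.apply]
  refine ContinuousLinearMap.isSelfAdjoint_iff_isSymmetric.1 ?_
  rw [IsSelfAdjoint, matAct, ← map_star, hstar]

end QuadraticForms

section Spaces

variable {d : ℕ} {D : Opens (EuclideanSpace ℝ (Fin d))}

theorem norm_sq_H1 (u : H1 D) : ‖u‖ ^ 2 = ‖fn D u‖ ^ 2 + ‖grad D u‖ ^ 2 :=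
  WithLp.prod_norm_sq_eq_of_L2 (H1.incl D u)

theorem inner_H1 (u v : H1 D) : ⟪u, v⟫_ℂ = ⟪fn D u, fn D v⟫_ℂ + ⟪grad D u, grad D v⟫_ℂ :=
  WithLp.prod_inner_apply (H1.incl D u) (H1.incl D v)

theorem isWeakGradient_grad (u : H1 D) : IsWeakGradient D (fn D u) (grad D u) :=
  (show H1Sub D from u).2

theorem norm_grad_apply_le (u : H1 D) : ‖grad D u‖ ≤ ‖u‖ :=
  le_of_sq_le_sq (by rw [norm_sq_H1]; exact le_add_of_nonneg_left (sq_nonneg _)) (norm_nonneg _)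

theorem norm_sq_X (U : X D) : ‖U‖ ^ 2 = ‖wPart D U‖ ^ 2 + ‖vPart D U‖ ^ 2 :=
  WithLp.prod_norm_sq_eq_of_L2 (X.incl D U)

theorem norm_wPart_apply_le (U : X D) : ‖wPart D U‖ ≤ ‖U‖ :=
  le_of_sq_le_sq (by rw [norm_sq_X]; exact le_add_of_nonneg_right (sq_nonneg _)) (norm_nonneg _)

theorem wPart_sub_vPart_mem_H10 (U : X D) : wPart D U - vPart D U ∈ H10 D :=
  (show XSub D from U).2

theorem X.ext {U V : X D} (hw : wPart D U = wPart D V) (hv : vPart D U = vPart D V) : U = V :=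
  Subtype.ext (WithLp.ofLp_injective 2 (Prod.ext hw hv))

variable (D) in
/-- The involution `(w, v) ↦ (w, 2w - v)` of `X(D)`, which makes the form coercive when the
coefficients exceed `1`. -/
def reflectV : X D →L[ℂ] X D :=
  ((WithLp.prodContinuousLinearEquiv 2 ℂ (H1 D) (H1 D)).symm ∘L
    (wPart D).prod ((2 : ℂ) • wPart D - vPart D)).codRestrict (XSub D) fun U => by
      have h := (H10 D).neg_mem (wPart_sub_vPart_mem_H10 U)
      change wPart D U - ((2 : ℂ) • wPart D U - vPart D U) ∈ H10 D
      convert h using 1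
      module

variable (D) in
/-- The involution `(w, v) ↦ (2v - w, v)` of `X(D)`, whose negative makes the form coercive when
the coefficients lie between `0` and `1`. -/
def reflectW : X D →L[ℂ] X D :=
  ((WithLp.prodContinuousLinearEquiv 2 ℂ (H1 D) (H1 D)).symm ∘L
    ((2 : ℂ) • vPart D - wPart D).prod (vPart D)).codRestrict (XSub D) fun U => by
      have h := (H10 D).neg_mem (wPart_sub_vPart_mem_H10 U)
      change (2 : ℂ) • vPart D U - wPart D U - vPart D U ∈ H10 D
      convert h using 1
      module

theorem wPart_reflectV (U : X D) : wPart D (reflectV D U) = wPart D U := rfl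

theorem vPart_reflectV (U : X D) :
    vPart D (reflectV D U) = (2 : ℂ) • wPart D U - vPart D U := rfl

theorem wPart_reflectW (U : X D) :
    wPart D (reflectW D U) = (2 : ℂ) • vPart D U - wPart D U := rfl

theorem vPart_reflectW (U : X D) : vPart D (reflectW D U) = vPart D U := rfl

theorem isUnit_reflectV : IsUnit (reflectV D) := by
  have h : reflectV D * reflectV D = 1 := by
    ext U
    refine X.ext ?_ ?_ <;> simp [wPart_reflectV, vPart_reflectV]
  exact ⟨⟨_, _, h, h⟩, rfl⟩

theorem isUnit_reflectW : IsUnit (reflectW D) := by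
  have h : reflectW D * reflectW D = 1 := by
    ext U
    refine X.ext ?_ ?_ <;> simp [wPart_reflectW, vPart_reflectW]
  exact ⟨⟨_, _, h, h⟩, rfl⟩

end Spaces

section CoeffMul

theorem re_inner_L2_mono {α E : Type*} [MeasurableSpace α] {μ : Measure α}
    [NormedAddCommGroup E] [InnerProductSpace ℂ E] {F G F' G' : Lp E 2 μ}
    (h : ∀ᵐ x ∂μ, (⟪F x, G x⟫_ℂ).re ≤ (⟪F' x, G' x⟫_ℂ).re) :
    (⟪F, G⟫_ℂ).re ≤ (⟪F', G'⟫_ℂ).re := by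
  have hint (F G : Lp E 2 μ) : (⟪F, G⟫_ℂ).re = ∫ x, (⟪F x, G x⟫_ℂ).re ∂μ := by
    rw [L2.inner_def]
    exact (integral_re (L2.integrable_inner (𝕜 := ℂ) F G)).symm
  rw [hint, hint]
  exact integral_mono_ae (L2.integrable_inner (𝕜 := ℂ) F G).re
    (L2.integrable_inner (𝕜 := ℂ) F' G').re h

variable {d : ℕ} (D : Opens (EuclideanSpace ℝ (Fin d)))

/-- Pointwise multiplication by a matrix field, as an operator of `L²(D; ℂ^d)`. -/
def coeffMul (a : Coeff d) : L2Vec D →L[ℂ] L2Vec D :=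
  (exists_coeffMul D a).choose

theorem coeffMul_ae_eq (a : Coeff d) (G : L2Vec D) :
    (coeffMul D a G : EuclideanSpace ℝ (Fin d) → EuclideanSpace ℂ (Fin d))
      =ᵐ[volume.restrict (D : Set (EuclideanSpace ℝ (Fin d)))]
        fun x => matAct (a.toFun x) (G x) :=
  (exists_coeffMul D a).choose_spec G

variable {D} {a : Coeff d}

theorem mul_norm_sq_le_re_inner_coeffMul {α : ℝ} (ha : ∀ x, α ≤ quadMin (a.toFun x))
    (G : L2Vec D) : α * ‖G‖ ^ 2 ≤ (⟪G, coeffMul D a G⟫_ℂ).re := by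
  have hα : α * ‖G‖ ^ 2 = (⟪G, (α : ℂ) • G⟫_ℂ).re := by
    rw [inner_smul_right, Complex.re_ofReal_mul]
    exact congrArg (α * ·) (inner_self_eq_norm_sq (𝕜 := ℂ) G).symm
  rw [hα]
  refine re_inner_L2_mono ?_
  filter_upwards [coeffMul_ae_eq D a G, Lp.coeFn_smul (α : ℂ) G] with x hx hαx
  rw [hx, hαx, Pi.smul_apply, inner_smul_right, Complex.re_ofReal_mul]
  refine le_trans ?_ (quadMin_mul_sq_le_re_inner _ _)
  rw [show (⟪G x, G x⟫_ℂ).re = ‖G x‖ ^ 2 from inner_self_eq_norm_sq (𝕜 := ℂ) _]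
  gcongr
  exact ha x

theorem re_inner_coeffMul_le_mul_norm_sq {β : ℝ} (ha : ∀ x, quadMax (a.toFun x) ≤ β)
    (G : L2Vec D) : (⟪G, coeffMul D a G⟫_ℂ).re ≤ β * ‖G‖ ^ 2 := by
  have hβ : β * ‖G‖ ^ 2 = (⟪G, (β : ℂ) • G⟫_ℂ).re := by
    rw [inner_smul_right, Complex.re_ofReal_mul]
    exact congrArg (β * ·) (inner_self_eq_norm_sq (𝕜 := ℂ) G).symm
  rw [hβ]
  refine re_inner_L2_mono ?_
  filter_upwards [coeffMul_ae_eq D a G, Lp.coeFn_smul (β : ℂ) G] with x hx hβx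
  rw [hx, hβx, Pi.smul_apply, inner_smul_right, Complex.re_ofReal_mul]
  refine (re_inner_le_quadMax_mul_sq _ _).trans ?_
  rw [show (⟪G x, G x⟫_ℂ).re = ‖G x‖ ^ 2 from inner_self_eq_norm_sq (𝕜 := ℂ) _]
  gcongr
  exact ha x

theorem isSymmetric_coeffMul (ha : ∀ x, (a.toFun x).IsSymm) :
    (coeffMul D a : L2Vec D →ₗ[ℂ] L2Vec D).IsSymmetric := by
  intro G H
  change ⟪coeffMul D a G, H⟫_ℂ = ⟪G, coeffMul D a H⟫_ℂ
  rw [L2.inner_def, L2.inner_def]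
  refine integral_congr_ae ?_
  filter_upwards [coeffMul_ae_eq D a G, coeffMul_ae_eq D a H] with x hG hH
  rw [hG, hH]
  exact isSymmetric_matAct (ha x) _ _

end CoeffMul

section EnergyOp

variable {d : ℕ} (D : Opens (EuclideanSpace ℝ (Fin d)))

/-- The operator of `H¹(D)` representing the `w`-part `∫_D a ∇w · ∇φ̄ + γ w φ̄` of the form. -/
def energyOp (a : Coeff d) (γ : ℝ) : H1 D →L[ℂ] H1 D :=
  (grad D).adjoint ∘L coeffMul D a ∘L grad D + (γ : ℂ) • ((fn D).adjoint ∘L fn D)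

variable {D} {a : Coeff d} {γ : ℝ}

theorem inner_energyOp (a : Coeff d) (γ : ℝ) (u v : H1 D) :
    ⟪u, energyOp D a γ v⟫_ℂ =
      ⟪grad D u, coeffMul D a (grad D v)⟫_ℂ + γ * ⟪fn D u, fn D v⟫_ℂ := by
  simp only [energyOp, add_apply, smul_apply, ContinuousLinearMap.comp_apply, inner_add_right,
    inner_smul_right, ContinuousLinearMap.adjoint_inner_right]

theorem re_inner_energyOp_self (a : Coeff d) (γ : ℝ) (u : H1 D) :
    (⟪u, energyOp D a γ u⟫_ℂ).re =
      (⟪grad D u, coeffMul D a (grad D u)⟫_ℂ).re + γ * ‖fn D u‖ ^ 2 := by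
  rw [inner_energyOp, Complex.add_re, Complex.re_ofReal_mul]
  exact congrArg (_ + γ * ·) (inner_self_eq_norm_sq (𝕜 := ℂ) (fn D u))

theorem isSymmetric_energyOp (ha : ∀ x, (a.toFun x).IsSymm) :
    (energyOp D a γ : H1 D →ₗ[ℂ] H1 D).IsSymmetric := by
  intro u v
  change ⟪energyOp D a γ u, v⟫_ℂ = ⟪u, energyOp D a γ v⟫_ℂ
  rw [← inner_conj_symm, inner_energyOp, inner_energyOp, map_add, map_mul, inner_conj_symm,
    inner_conj_symm, Complex.conj_ofReal]
  exact congrArg (· + _) (isSymmetric_coeffMul ha (grad D u) (grad D v))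

theorem mul_norm_sq_le_re_inner_energyOp {α : ℝ} (hαγ : α ≤ γ)
    (ha : ∀ x, α ≤ quadMin (a.toFun x)) (u : H1 D) :
    α * ‖u‖ ^ 2 ≤ (⟪u, energyOp D a γ u⟫_ℂ).re := by
  rw [re_inner_energyOp_self, norm_sq_H1, mul_add, add_comm]
  gcongr
  exact mul_norm_sq_le_re_inner_coeffMul ha (grad D u)

theorem re_inner_energyOp_le_mul_norm_sq {β : ℝ} (hγβ : γ ≤ β)
    (ha : ∀ x, quadMax (a.toFun x) ≤ β) (u : H1 D) :
    (⟪u, energyOp D a γ u⟫_ℂ).re ≤ β * ‖u‖ ^ 2 := by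
  rw [re_inner_energyOp_self, norm_sq_H1, mul_add, add_comm]
  gcongr
  exact re_inner_coeffMul_le_mul_norm_sq ha (grad D u)

theorem inner_op_eq_inner_energyOp_sub (a : Coeff d) (γ : ℝ) (U Φ : X D) :
    ⟪Φ, op D a γ U⟫_ℂ =
      ⟪wPart D Φ, energyOp D a γ (wPart D U)⟫_ℂ - ⟪vPart D Φ, vPart D U⟫_ℂ := by
  have hgrad : (fun x => ⟪grad D (wPart D Φ) x, coeffMul D a (grad D (wPart D U)) x⟫_ℂ)
      =ᵐ[volume.restrict (D : Set (EuclideanSpace ℝ (Fin d)))]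
        fun x => ⟪grad D (wPart D Φ) x, matAct (a.toFun x) (grad D (wPart D U) x)⟫_ℂ := by
    filter_upwards [coeffMul_ae_eq D a (grad D (wPart D U))] with x hx
    rw [hx]
  rw [inner_op, form, inner_energyOp, inner_H1, L2.inner_def, L2.inner_def, L2.inner_def,
    L2.inner_def, integral_congr_ae hgrad, integral_add
    ((L2.integrable_inner _ _).congr hgrad) ((L2.integrable_inner _ _).const_mul _),
    integral_add (L2.integrable_inner _ _) (L2.integrable_inner _ _), integral_const_mul]
  ring

theorem isTCoercive_op_reflectV {α : ℝ} (hα : 1 ≤ α) (hαγ : α ≤ γ)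
    (ha : ∀ x, α ≤ quadMin (a.toFun x)) :
    IsTCoercive (reflectV D) (op D a γ) (1 - (√α)⁻¹) := by
  intro U
  rw [inner_op_eq_inner_energyOp_sub, wPart_reflectV, vPart_reflectV, norm_sq_X]
  exact one_sub_inv_sqrt_mul_le_re_inner hα (mul_norm_sq_le_re_inner_energyOp hαγ ha) _ _

theorem isTCoercive_op_neg_reflectW {α β : ℝ} (hα : 0 ≤ α) (hβ : β ∈ Set.Ioc 0 1)
    (hγ : γ ∈ Set.Icc α β) (ha : ∀ x, (a.toFun x).IsSymm) (hαa : ∀ x, α ≤ quadMin (a.toFun x))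
    (haβ : ∀ x, quadMax (a.toFun x) ≤ β) :
    IsTCoercive (-reflectW D) (op D a γ) ((1 - √β) * α) := by
  intro U
  rw [inner_op_eq_inner_energyOp_sub, neg_apply, map_neg, map_neg, wPart_reflectW,
    vPart_reflectW, neg_sub, norm_sq_X]
  exact one_sub_sqrt_mul_le_re_inner hα hβ (isSymmetric_energyOp ha)
    (mul_norm_sq_le_re_inner_energyOp hγ.1 hαa) (re_inner_energyOp_le_mul_norm_sq hγ.2 haβ) _ _

theorem op_sub_op_apply (a b : Coeff d) (γ : ℝ) (U : X D) :
    op D a γ U - op D b γ U = (grad D ∘L wPart D).adjoint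
      (coeffMul D a (grad D (wPart D U)) - coeffMul D b (grad D (wPart D U))) := by
  refine ext_inner_left ℂ fun Φ => ?_
  rw [ContinuousLinearMap.adjoint_inner_right, inner_sub_right, inner_sub_right,
    inner_op_eq_inner_energyOp_sub, inner_op_eq_inner_energyOp_sub, inner_energyOp,
    inner_energyOp, ContinuousLinearMap.comp_apply]
  ring

theorem norm_op_sub_op_apply_le (a b : Coeff d) (γ : ℝ) (U : X D) :
    ‖op D a γ U - op D b γ U‖ ≤
      ‖coeffMul D a (grad D (wPart D U)) - coeffMul D b (grad D (wPart D U))‖ := by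
  have hnorm : ‖grad D ∘L wPart D‖ ≤ 1 :=
    ContinuousLinearMap.opNorm_le_bound _ zero_le_one fun Φ => by
      rw [one_mul]
      exact (norm_grad_apply_le _).trans (norm_wPart_apply_le _)
  rw [op_sub_op_apply, ← one_mul ‖coeffMul D a _ - _‖]
  exact ContinuousLinearMap.le_of_opNorm_le _ ((LinearIsometryEquiv.norm_map _ _).trans_le hnorm) _

end EnergyOp

section UniformTCoercivity

variable {d : ℕ} (D : Opens (EuclideanSpace ℝ (Fin d))) {s : Set (Matrix (Fin d) (Fin d) ℝ)}
  {γ : ℝ}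

theorem exists_forall_isTCoercive_op_reflectV (hs : s.Finite) (hγ : 1 < γ)
    (hmin : ∀ A ∈ s, 1 < quadMin A) :
    ∃ c > 0, ∀ a : Coeff d, (∀ x, a.toFun x ∈ s) → IsTCoercive (reflectV D) (op D a γ) c := by
  obtain ⟨α, hα, hαs⟩ := (Set.finite_singleton 1).exists_between (Set.singleton_nonempty 1)
    ((hs.image quadMin).insert γ) (Set.insert_nonempty _ _)
    (by simpa using ⟨hγ, hmin⟩)
  simp only [Set.mem_singleton_iff, forall_eq, Set.forall_mem_insert, Set.forall_mem_image]
    at hα hαs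
  have hα1 : 1 < √α := Real.lt_sqrt_of_sq_lt (by rwa [one_pow])
  exact ⟨1 - (√α)⁻¹, sub_pos.2 (inv_lt_one_of_one_lt₀ hα1), fun a ha =>
    isTCoercive_op_reflectV hα.le hαs.1.le fun x => (hαs.2 (ha x)).le⟩

theorem exists_forall_isTCoercive_op_neg_reflectW (hs : s.Finite) (hγ : γ ∈ Set.Ioo 0 1)
    (hsymm : ∀ A ∈ s, A.IsSymm) (hmin : ∀ A ∈ s, 0 < quadMin A) (hmax : ∀ A ∈ s, quadMax A < 1) :
    ∃ c > 0, ∀ a : Coeff d, (∀ x, a.toFun x ∈ s) → IsTCoercive (-reflectW D) (op D a γ) c := by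
  obtain ⟨α, hα, hαs⟩ := (Set.finite_singleton 0).exists_between (Set.singleton_nonempty 0)
    ((hs.image quadMin).insert γ) (Set.insert_nonempty _ _)
    (by simpa using ⟨hγ.1, hmin⟩)
  obtain ⟨β, hβs, hβ⟩ := ((hs.image quadMax).insert γ).exists_between (Set.insert_nonempty _ _)
    (Set.finite_singleton 1) (Set.singleton_nonempty 1)
    (by simpa using ⟨hγ.2, hmax⟩)
  simp only [Set.mem_singleton_iff, forall_eq, Set.forall_mem_insert, Set.forall_mem_image]
    at hα hαs hβ hβs
  have hβ0 : 0 < β := hγ.1.trans hβs.1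
  refine ⟨(1 - √β) * α, mul_pos (sub_pos.2 ?_) hα, fun a ha => ?_⟩
  · rwa [Real.sqrt_lt' one_pos, one_pow]
  · exact isTCoercive_op_neg_reflectW hα.le ⟨hβ0, hβ.le⟩ ⟨hαs.1.le, hβs.1.le⟩
      (fun x => hsymm _ (ha x)) (fun x => (hαs.2 (ha x)).le) fun x => (hβs.2 (ha x)).le

theorem exists_forall_isTCoercive_op (hs : s.Finite)
    (hγ : (1 < γ ∧ ∀ A ∈ s, 1 < quadMin A) ∨
      (γ ∈ Set.Ioo 0 1 ∧ ∀ A ∈ s, A.IsSymm ∧ 0 < quadMin A ∧ quadMax A < 1)) :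
    ∃ T : X D →L[ℂ] X D, IsUnit T ∧
      ∃ c > 0, ∀ a : Coeff d, (∀ x, a.toFun x ∈ s) → IsTCoercive T (op D a γ) c := by
  rcases hγ with ⟨hγ, hmin⟩ | ⟨hγ, h⟩
  · exact ⟨_, isUnit_reflectV, exists_forall_isTCoercive_op_reflectV D hs hγ hmin⟩
  · exact ⟨_, isUnit_reflectW.neg, exists_forall_isTCoercive_op_neg_reflectW D hs hγ
      (fun A hA => (h A hA).1) (fun A hA => (h A hA).2.1) fun A hA => (h A hA).2.2⟩

end UniformTCoercivity

section Region

variable {d : ℕ} {z : EuclideanSpace ℝ (Fin d)} {B : Set (EuclideanSpace ℝ (Fin d))}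

theorem region_eq_singleton_add_smul (z : EuclideanSpace ℝ (Fin d))
    (B : Set (EuclideanSpace ℝ (Fin d))) (ε : ℝ) : region z B ε = {z} + ε • B := by
  rw [Set.singleton_add, ← Set.image_smul, Set.image_image, region]

theorem volume_region (z : EuclideanSpace ℝ (Fin d)) (B : Set (EuclideanSpace ℝ (Fin d)))
    (ε : ℝ) : volume (region z B ε) = ENNReal.ofReal |ε ^ d| * volume B := by
  rw [region_eq_singleton_add_smul, Set.singleton_add, Set.image_add_left, measure_preimage_add,
    Measure.addHaar_smul, finrank_euclideanSpace_fin]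

theorem eventually_region_subset (hB : Bornology.IsBounded B)
    {u : Set (EuclideanSpace ℝ (Fin d))} (hu : u ∈ 𝓝 z) : ∀ᶠ ε in 𝓝 (0 : ℝ), region z B ε ⊆ u := by
  simpa only [region_eq_singleton_add_smul] using eventually_singleton_add_smul_subset hB hu

theorem eventually_pairwise_disjoint_region {ι : Type*} [Finite ι]
    {z : ι → EuclideanSpace ℝ (Fin d)} (hz : Function.Injective z)
    {B : ι → Set (EuclideanSpace ℝ (Fin d))} (hB : ∀ i, Bornology.IsBounded (B i)) :
    ∀ᶠ ε in 𝓝 (0 : ℝ),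
      Pairwise fun i j => Disjoint (region (z i) (B i) ε) (region (z j) (B j) ε) := by
  simp only [Pairwise, eventually_all]
  intro i j hij
  obtain ⟨u, hu, v, hv, huv⟩ := Filter.disjoint_iff.1 (disjoint_nhds_nhds.2 (hz.ne hij))
  filter_upwards [eventually_region_subset (hB i) hu, eventually_region_subset (hB j) hv]
    with ε hi hj using huv.mono hi hj

theorem eLpNorm_restrict_region_le {F : Type*} [NormedAddCommGroup F] {p : ℝ≥0∞}
    {μ : Measure (EuclideanSpace ℝ (Fin d))} (hμ : μ ≤ volume) (hB : MeasurableSet B)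
    {f : EuclideanSpace ℝ (Fin d) → F} {ε K : ℝ} (hε : 0 < ε)
    (hf : ∀ᵐ x ∂μ, x ∈ region z B ε → ‖f x‖ ≤ K) :
    eLpNorm f p (μ.restrict (region z B ε)) ≤
      volume B ^ p.toReal⁻¹ * ENNReal.ofReal K * ENNReal.ofReal (ε ^ ((d : ℝ) / p.toReal)) := by
  have hvol : (μ.restrict (region z B ε)) Set.univ ≤ ENNReal.ofReal (ε ^ d) * volume B := by
    rw [Measure.restrict_apply_univ, ← abs_of_pos (pow_pos hε d), ← volume_region z B ε]
    exact hμ _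
  have hpow : ENNReal.ofReal (ε ^ d) ^ p.toReal⁻¹ = ENNReal.ofReal (ε ^ ((d : ℝ) / p.toReal)) := by
    rw [ENNReal.ofReal_rpow_of_pos (pow_pos hε d), div_eq_mul_inv, Real.rpow_mul hε.le,
      Real.rpow_natCast]
  calc eLpNorm f p (μ.restrict (region z B ε))
    _ ≤ (μ.restrict (region z B ε)) Set.univ ^ p.toReal⁻¹ * ENNReal.ofReal K :=
      eLpNorm_le_of_ae_bound ((ae_restrict_iff' (measurableSet_region z hB ε)).2 hf)
    _ ≤ (ENNReal.ofReal (ε ^ d) * volume B) ^ p.toReal⁻¹ * ENNReal.ofReal K := by gcongr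
    _ = _ := by
      rw [ENNReal.mul_rpow_of_nonneg _ _ (inv_nonneg.2 ENNReal.toReal_nonneg), hpow]
      ring

-- The hypothesis `hf` says that `f` is `μ`-essentially bounded near `z`.
theorem isBigO_eLpNorm_restrict_region {F : Type*} [NormedAddCommGroup F] {p : ℝ≥0∞}
    {μ : Measure (EuclideanSpace ℝ (Fin d))} (hμ : μ ≤ volume) (hBmeas : MeasurableSet B)
    (hBbdd : Bornology.IsBounded B) {f : EuclideanSpace ℝ (Fin d) → F}
    (hf : f =O[𝓝 z ⊓ ae μ] fun _ => (1 : ℝ)) :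
    (fun ε : ℝ => (eLpNorm f p (μ.restrict (region z B ε))).toReal)
      =O[𝓝[>] 0] fun ε : ℝ => ε ^ ((d : ℝ) / p.toReal) := by
  obtain ⟨K, hK⟩ := hf.bound
  obtain ⟨u, hu, t, ht, hut⟩ := Filter.mem_inf_iff_superset.1 hK
  refine .of_bound ((volume B ^ p.toReal⁻¹ * ENNReal.ofReal K).toReal) ?_
  filter_upwards [nhdsWithin_le_nhds (eventually_region_subset hBbdd hu), self_mem_nhdsWithin]
    with ε hε (hε0 : 0 < ε)
  have hbound : ∀ᵐ x ∂μ, x ∈ region z B ε → ‖f x‖ ≤ K := by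
    filter_upwards [ht] with x hxt hx
    simpa using hut ⟨hε hx, hxt⟩
  have hfin : volume B ^ p.toReal⁻¹ * ENNReal.ofReal K ≠ ⊤ :=
    ENNReal.mul_ne_top (ENNReal.rpow_ne_top_of_nonneg (inv_nonneg.2 ENNReal.toReal_nonneg)
      hBbdd.measure_lt_top.ne) ENNReal.ofReal_ne_top
  have hnonneg : 0 ≤ ε ^ ((d : ℝ) / p.toReal) := Real.rpow_nonneg hε0.le _
  rw [Real.norm_of_nonneg ENNReal.toReal_nonneg, Real.norm_of_nonneg hnonneg]
  conv_rhs => rw [← ENNReal.toReal_ofReal hnonneg, ← ENNReal.toReal_mul]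
  exact ENNReal.toReal_mono (ENNReal.mul_ne_top hfin ENNReal.ofReal_ne_top)
    (eLpNorm_restrict_region_le hμ hBmeas hε0 hbound)

end Region

section DefectCoeff

variable {d : ℕ} {D : Opens (EuclideanSpace ℝ (Fin d))} {M : ℕ}
  {A : Matrix (Fin d) (Fin d) ℝ} {Am : Fin M → Matrix (Fin d) (Fin d) ℝ}
  {z : Fin M → EuclideanSpace ℝ (Fin d)} {B : Fin M → Set (EuclideanSpace ℝ (Fin d))}

theorem defectCoeff_mem_insert_range (hB : ∀ m, MeasurableSet (B m)) {ε : ℝ}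
    (hdisj : Pairwise fun i j => Disjoint (region (z i) (B i) ε) (region (z j) (B j) ε))
    (x : EuclideanSpace ℝ (Fin d)) :
    (defectCoeff A Am z B hB ε).toFun x ∈ insert A (Set.range Am) := by
  by_cases hx : ∃ m, x ∈ region (z m) (B m) ε
  · obtain ⟨m, hm⟩ := hx
    exact .inr ⟨m, (defectCoeff_of_mem A Am z B hB ε hdisj m hm).symm⟩
  · exact .inl (defectCoeff_of_notMem A Am z B hB ε (not_exists.1 hx))

theorem matAct_defectCoeff (hB : ∀ m, MeasurableSet (B m)) (ε : ℝ) (x : EuclideanSpace ℝ (Fin d))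
    (ξ : EuclideanSpace ℂ (Fin d)) :
    matAct ((defectCoeff A Am z B hB ε).toFun x) ξ =
      matAct A ξ + ∑ m, (region (z m) (B m) ε).indicator (fun _ => matAct (Am m - A) ξ) x := by
  classical
  have hmat (a : Matrix (Fin d) (Fin d) ℝ) :
      matAct a = Matrix.toEuclideanCLM (n := Fin d) (𝕜 := ℂ) (Complex.ofRealHom.mapMatrix a) := rfl
  simp only [hmat, defectCoeff, map_add, map_sum, add_apply, sum_apply,
    apply_ite Complex.ofRealHom.mapMatrix, apply_ite (Matrix.toEuclideanCLM (n := Fin d) (𝕜 := ℂ)),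
    map_zero, Set.indicator_apply]
  congr 1
  refine Finset.sum_congr rfl fun m _ => ?_
  split_ifs <;> rfl

/-- The vector field `1_S G`, which vanishes outside the measurable set `S`. -/
def truncate {S : Set (EuclideanSpace ℝ (Fin d))} (hS : MeasurableSet S) (G : L2Vec D) : L2Vec D :=
  ((Lp.memLp G).indicator hS).toLp _

theorem truncate_ae_eq {S : Set (EuclideanSpace ℝ (Fin d))} (hS : MeasurableSet S)
    (G : L2Vec D) :
    (truncate hS G : EuclideanSpace ℝ (Fin d) → EuclideanSpace ℂ (Fin d))
      =ᵐ[volume.restrict (D : Set (EuclideanSpace ℝ (Fin d)))] S.indicator G :=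
  MemLp.coeFn_toLp _

theorem norm_truncate {S : Set (EuclideanSpace ℝ (Fin d))} (hS : MeasurableSet S)
    (G : L2Vec D) :
    ‖truncate hS G‖ = (eLpNorm G 2
      ((volume.restrict (D : Set (EuclideanSpace ℝ (Fin d)))).restrict S)).toReal := by
  rw [truncate, Lp.norm_toLp, eLpNorm_indicator_eq_eLpNorm_restrict hS]

theorem coeffMul_defectCoeff_sub_constCoeff (hB : ∀ m, MeasurableSet (B m)) (ε : ℝ)
    (G : L2Vec D) :
    coeffMul D (defectCoeff A Am z B hB ε) G - coeffMul D (constCoeff A) G =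
      ∑ m, (matAct (Am m - A)).compLp
        (truncate (measurableSet_region (z m) (hB m) ε) G) := by
  ext1
  have hdefect : ∀ᵐ x ∂volume.restrict (D : Set (EuclideanSpace ℝ (Fin d))), ∀ m,
      (matAct (Am m - A)).compLp (truncate (measurableSet_region (z m) (hB m) ε) G) x =
        (region (z m) (B m) ε).indicator (fun _ => matAct (Am m - A) (G x)) x := by
    refine ae_all_iff.2 fun m => ?_
    filter_upwards [(matAct (Am m - A)).coeFn_compLp
      (truncate (measurableSet_region (z m) (hB m) ε) G),
      truncate_ae_eq (measurableSet_region (z m) (hB m) ε) G] with x hcomp htrunc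
    rw [hcomp, htrunc]
    by_cases hx : x ∈ region (z m) (B m) ε
    · rw [Set.indicator_of_mem hx, Set.indicator_of_mem hx]
    · rw [Set.indicator_of_notMem hx, Set.indicator_of_notMem hx, map_zero]
  filter_upwards [hdefect, Lp.coeFn_sub (coeffMul D (defectCoeff A Am z B hB ε) G)
    (coeffMul D (constCoeff A) G), Lp.coeFn_finsetSum Finset.univ fun m =>
    (matAct (Am m - A)).compLp (truncate (measurableSet_region (z m) (hB m) ε) G),
    coeffMul_ae_eq D (defectCoeff A Am z B hB ε) G, coeffMul_ae_eq D (constCoeff A) G]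
    with x hdefect hsub hsum hε hconst
  rw [hsub, hsum, Pi.sub_apply, Finset.sum_apply, hε, hconst, matAct_defectCoeff,
    Finset.sum_congr rfl fun m _ => hdefect m]
  exact add_sub_cancel_left _ _

theorem isBigO_coeffMul_defectCoeff_sub_constCoeff (hBmeas : ∀ m, MeasurableSet (B m))
    (hBbdd : ∀ m, Bornology.IsBounded (B m)) {G : L2Vec D}
    (hG : ∀ m, G =O[𝓝 (z m) ⊓ ae (volume.restrict (D : Set (EuclideanSpace ℝ (Fin d))))]
      fun _ => (1 : ℝ)) :
    (fun ε : ℝ => coeffMul D (defectCoeff A Am z B hBmeas ε) G - coeffMul D (constCoeff A) G)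
      =O[𝓝[>] 0] fun ε : ℝ => ε ^ ((d : ℝ) / 2) := by
  simp only [coeffMul_defectCoeff_sub_constCoeff]
  refine .fun_sum fun m _ => ?_
  have htrunc : (fun ε : ℝ => truncate (measurableSet_region (z m) (hBmeas m) ε) G)
      =O[𝓝[>] 0] fun ε : ℝ => ε ^ ((d : ℝ) / 2) := by
    refine Asymptotics.isBigO_norm_left.1 ?_
    simp only [norm_truncate]
    exact isBigO_eLpNorm_restrict_region Measure.restrict_le_self (hBmeas m) (hBbdd m) (hG m)
  exact (((matAct (Am m - A)).compLpL 2 _).isBigO_comp _ _).trans htrunc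

end DefectCoeff

section ClassicalGradient

variable {d : ℕ} {D : Opens (EuclideanSpace ℝ (Fin d))} {f g W : EuclideanSpace ℝ (Fin d) → ℂ}

theorem integrable_mul_of_tsupport_subset (hf : ContinuousOn f D) (hg : Continuous g)
    (hgc : HasCompactSupport g) (hgD : tsupport g ⊆ D) : Integrable fun x => f x * g x := by
  refine Continuous.integrable_of_hasCompactSupport (continuous_of_tsupport fun x hx => ?_)
    hgc.mul_left
  have hxD : x ∈ D := hgD (tsupport_mul_subset_right hx)
  exact (hf.continuousAt (D.isOpen.mem_nhds hxD)).mul hg.continuousAt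

theorem setIntegral_mul_of_tsupport_subset (hgD : tsupport g ⊆ D) :
    ∫ x in (D : Set (EuclideanSpace ℝ (Fin d))), f x * g x = ∫ x, f x * g x :=
  setIntegral_eq_integral_of_forall_compl_eq_zero fun _ hx => by
    rw [image_eq_zero_of_notMem_tsupport fun h => hx (hgD h), mul_zero]

theorem setIntegral_mul_fderiv_test (hW : ContDiffOn ℝ 1 W D) (φ : 𝓓(D, ℂ))
    (e : EuclideanSpace ℝ (Fin d)) :
    ∫ x in (D : Set (EuclideanSpace ℝ (Fin d))), W x * fderiv ℝ φ x e =
      -∫ x in (D : Set (EuclideanSpace ℝ (Fin d))), fderiv ℝ W x e * φ x := by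
  have hφ'D : tsupport (fun x => fderiv ℝ φ x e) ⊆ D :=
    (tsupport_fderiv_apply_subset ℝ e).trans φ.tsupport_subset
  have hφ' : Continuous fun x => fderiv ℝ φ x e :=
    (φ.contDiff.continuous_fderiv (by simp)).clm_apply continuous_const
  have hW' : ContinuousOn (fun x => fderiv ℝ W x e) D :=
    (hW.continuousOn_fderiv_of_isOpen D.isOpen le_rfl).clm_apply continuousOn_const
  rw [setIntegral_mul_of_tsupport_subset hφ'D,
    setIntegral_mul_of_tsupport_subset φ.tsupport_subset]
  exact integral_mul_fderiv_eq_neg_fderiv_mul_of_integrable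
    (integrable_mul_of_tsupport_subset hW' φ.continuous φ.hasCompactSupport φ.tsupport_subset)
    (integrable_mul_of_tsupport_subset hW.continuousOn hφ'
      (φ.hasCompactSupport.fderiv_apply (𝕜 := ℝ) e) hφ'D)
    (integrable_mul_of_tsupport_subset hW.continuousOn φ.continuous φ.hasCompactSupport
      φ.tsupport_subset)
    (fun x hx => (hW.differentiableOn one_ne_zero).differentiableAt
      (D.isOpen.mem_nhds (φ.tsupport_subset hx)))
    fun x _ => φ.contDiff.differentiable (by simp) x

theorem ae_eq_zero_of_forall_setIntegral_mul_test_eq_zero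
    (hf : LocallyIntegrableOn f (D : Set (EuclideanSpace ℝ (Fin d))))
    (h : ∀ φ : 𝓓(D, ℂ), ∫ x in (D : Set (EuclideanSpace ℝ (Fin d))), f x * φ x = 0) :
    f =ᵐ[volume.restrict (D : Set (EuclideanSpace ℝ (Fin d)))] 0 := by
  rw [EventuallyEq, ae_restrict_iff' D.isOpen.measurableSet]
  refine IsOpen.ae_eq_zero_of_integral_contDiff_smul_eq_zero D.isOpen hf fun g hg hgc hgD => ?_
  have hsupp : tsupport (fun x => (g x : ℂ)) ⊆ D :=
    (closure_mono fun x hx => Complex.ofReal_ne_zero.1 hx).trans hgD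
  have hint := h ⟨fun x => (g x : ℂ), Complex.ofRealCLM.contDiff.comp hg,
    hgc.comp_left Complex.ofReal_zero, hsupp⟩
  rw [setIntegral_mul_of_tsupport_subset (TestFunction.tsupport_subset _)] at hint
  rw [← hint]
  exact integral_congr_ae (.of_forall fun x => (Complex.real_smul ..).trans (mul_comm ..))

theorem grad_apply_ae_eq_fderiv {u : H1 D} (hW : ContDiffOn ℝ 1 W D)
    (hu : (fn D u : EuclideanSpace ℝ (Fin d) → ℂ)
      =ᵐ[volume.restrict (D : Set (EuclideanSpace ℝ (Fin d)))] W) (i : Fin d) :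
    (fun x => grad D u x i) =ᵐ[volume.restrict (D : Set (EuclideanSpace ℝ (Fin d)))]
      fun x => fderiv ℝ W x (EuclideanSpace.single i 1) := by
  have hW' : ContinuousOn (fun x => fderiv ℝ W x (EuclideanSpace.single i 1)) D :=
    (hW.continuousOn_fderiv_of_isOpen D.isOpen le_rfl).clm_apply continuousOn_const
  have hgrad : LocallyIntegrableOn (fun x => grad D u x i)
      (D : Set (EuclideanSpace ℝ (Fin d))) :=
    locallyIntegrableOn_of_locallyIntegrable_restrict
      ((memLp_coord (grad D u) i).locallyIntegrable one_le_two)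
  have hzero := ae_eq_zero_of_forall_setIntegral_mul_test_eq_zero
    (hgrad.sub (hW'.locallyIntegrableOn D.isOpen.measurableSet)) fun φ => ?_
  · filter_upwards [hzero] with x hx using sub_eq_zero.1 hx
  have hweak : ∫ x in (D : Set (EuclideanSpace ℝ (Fin d))), grad D u x i * φ x =
      ∫ x in (D : Set (EuclideanSpace ℝ (Fin d))),
        fderiv ℝ W x (EuclideanSpace.single i 1) * φ x := by
    rw [← neg_inj, ← setIntegral_mul_fderiv_test hW, ← isWeakGradient_grad u φ i]
    refine integral_congr_ae ?_
    filter_upwards [hu] with x hx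
    rw [hx]
  simp only [Pi.sub_apply, sub_mul]
  rw [integral_sub (integrable_right _ φ i) (integrable_mul_of_tsupport_subset hW' φ.continuous
    φ.hasCompactSupport φ.tsupport_subset).restrict, hweak, sub_self]

theorem grad_isBigO_one_nhds {u : H1 D} (hW : ContDiffOn ℝ 1 W D)
    (hu : (fn D u : EuclideanSpace ℝ (Fin d) → ℂ)
      =ᵐ[volume.restrict (D : Set (EuclideanSpace ℝ (Fin d)))] W)
    {z : EuclideanSpace ℝ (Fin d)} (hz : z ∈ D) :
    grad D u =O[𝓝 z ⊓ ae (volume.restrict (D : Set (EuclideanSpace ℝ (Fin d))))]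
      fun _ => (1 : ℝ) := by
  set G : EuclideanSpace ℝ (Fin d) → EuclideanSpace ℂ (Fin d) := fun x =>
    WithLp.toLp 2 fun i => fderiv ℝ W x (EuclideanSpace.single i 1)
  have hG : ContinuousAt G z := by
    have hW' : ContinuousAt (fderiv ℝ W) z :=
      (hW.continuousOn_fderiv_of_isOpen D.isOpen le_rfl).continuousAt (D.isOpen.mem_nhds hz)
    fun_prop
  have hgrad : grad D u =ᵐ[volume.restrict (D : Set (EuclideanSpace ℝ (Fin d)))] G := by
    filter_upwards [ae_all_iff.2 (grad_apply_ae_eq_fderiv hW hu)] with x hx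
    ext i
    exact hx i
  exact (hgrad.filter_mono inf_le_right).trans_isBigO
    ((hG.tendsto.isBigO_one ℝ).mono inf_le_left)

end ClassicalGradient

end TransmissionDefect

end

open TransmissionDefect in
theorem mainTheorem11_general {d : ℕ} (D : Opens (EuclideanSpace ℝ (Fin d))) {M : ℕ}
    (A : Matrix (Fin d) (Fin d) ℝ) (Am : Fin M → Matrix (Fin d) (Fin d) ℝ)
    {z : Fin M → EuclideanSpace ℝ (Fin d)} (hz : Function.Injective z)
    {B : Fin M → Set (EuclideanSpace ℝ (Fin d))}
    (hBmeas : ∀ m, MeasurableSet (B m)) (hBbdd : ∀ m, Bornology.IsBounded (B m)) {γ : ℝ}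
    (hγ : (1 < γ ∧ ∀ a ∈ insert A (Set.range Am), 1 < quadMin a) ∨
      (γ ∈ Set.Ioo 0 1 ∧
        ∀ a ∈ insert A (Set.range Am), a.IsSymm ∧ 0 < quadMin a ∧ quadMax a < 1)) :
    (op D (constCoeff A) γ).IsInvertible ∧
    (∀ ε : ℝ,
      (Pairwise fun i j => Disjoint (region (z i) (B i) ε) (region (z j) (B j) ε)) →
        (op D (defectCoeff A Am z B hBmeas ε) γ).IsInvertible) ∧
    ∀ (F U : X D) (Uε : ℝ → X D),
      U = (op D (constCoeff A) γ).inverse F →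
      (∀ ε : ℝ, 0 < ε → Uε ε = (op D (defectCoeff A Am z B hBmeas ε) γ).inverse F) →
      (∀ m, grad D (wPart D U)
        =O[𝓝 (z m) ⊓ ae (volume.restrict (D : Set (EuclideanSpace ℝ (Fin d))))]
          fun _ => (1 : ℝ)) →
      (fun ε : ℝ => ‖wPart D (Uε ε) - wPart D U‖ + ‖vPart D (Uε ε) - vPart D U‖)
        =O[𝓝[>] 0] fun ε : ℝ => ε ^ ((d : ℝ) / 2) := by
  obtain ⟨T, hT, c, hc, hcoercive⟩ :=
    exists_forall_isTCoercive_op D ((Set.finite_range Am).insert A) hγ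
  have hconst := (hcoercive (constCoeff A) fun _ => Set.mem_insert A _).isInvertible hc hT
  have hdefect (ε : ℝ) (hε : Pairwise fun i j =>
      Disjoint (region (z i) (B i) ε) (region (z j) (B j) ε)) :=
    hcoercive _ (defectCoeff_mem_insert_range (A := A) (Am := Am) hBmeas hε)
  refine ⟨hconst, fun ε hε => (hdefect ε hε).isInvertible hc hT, fun F U Uε hU hUε hgrad => ?_⟩
  have hsource :=
    isBigO_coeffMul_defectCoeff_sub_constCoeff (A := A) (Am := Am) hBmeas hBbdd hgrad
  have herror : (fun ε => Uε ε - U) =O[𝓝[>] 0] fun ε : ℝ => ε ^ ((d : ℝ) / 2) := by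
    refine Asymptotics.IsBigO.trans (.of_bound (‖T‖ / c) ?_) hsource
    filter_upwards [self_mem_nhdsWithin,
      nhdsWithin_le_nhds (eventually_pairwise_disjoint_region hz hBbdd)] with ε hε0 hε
    have heq : op D (defectCoeff A Am z B hBmeas ε) γ (Uε ε) = op D (constCoeff A) γ U := by
      rw [hUε ε hε0, hU, ((hdefect ε hε).isInvertible hc hT).self_apply_inverse,
        hconst.self_apply_inverse]
    rw [norm_sub_rev (coeffMul D _ _)]
    exact ((hdefect ε hε).norm_sub_le hc heq).trans
      (mul_le_mul_of_nonneg_left (norm_op_sub_op_apply_le _ _ _ _) (by positivity))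
  simp only [← map_sub]
  exact (((wPart D).isBigO_comp _ _).trans herror).norm_left.add
    (((vPart D).isBigO_comp _ _).trans herror).norm_left

theorem mainTheorem11 (d : ℕ) (hd : d = 2 ∨ d = 3)
    (D : TopologicalSpace.Opens (EuclideanSpace ℝ (Fin d)))
    (hD : Bornology.IsBounded (D : Set (EuclideanSpace ℝ (Fin d))))
    (M : ℕ)
    (A : Matrix (Fin d) (Fin d) ℝ) (hA : A.IsSymm)
    (Am : Fin M → Matrix (Fin d) (Fin d) ℝ) (hAm : ∀ m, (Am m).IsSymm)
    (z : Fin M → EuclideanSpace ℝ (Fin d)) (hz : Function.Injective z) (hzD : ∀ m, z m ∈ D)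
    (B : Fin M → Set (EuclideanSpace ℝ (Fin d)))
    (hBmeas : ∀ m, MeasurableSet (B m)) (hBbdd : ∀ m, Bornology.IsBounded (B m))
    (γ : ℝ)
    (hγ : (1 < TransmissionDefect.quadMin A ∧ (∀ m, 1 < TransmissionDefect.quadMin (Am m)) ∧
            γ = TransmissionDefect.quadMin A) ∨
          (0 < TransmissionDefect.quadMin A ∧ (∀ m, 0 < TransmissionDefect.quadMin (Am m)) ∧
            TransmissionDefect.quadMax A < 1 ∧ (∀ m, TransmissionDefect.quadMax (Am m) < 1) ∧
            γ = TransmissionDefect.quadMax A)) :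
    -- the operators `𝐀₀` and `𝐀_ε` are invertible
    (TransmissionDefect.op D (TransmissionDefect.constCoeff A) γ).IsInvertible ∧
    (∀ ε : ℝ, 0 < ε →
      (Pairwise fun i j => Disjoint (TransmissionDefect.region (z i) (B i) ε)
        (TransmissionDefect.region (z j) (B j) ε)) →
      (TransmissionDefect.op D
        (TransmissionDefect.defectCoeff A Am z B hBmeas ε) γ).IsInvertible) ∧
    -- the estimate for `(w, v) = 𝐀₀⁻¹ F` and `(w_ε, v_ε) = 𝐀_ε⁻¹ F`, where `F = (f, g)`
    ∀ (F U : TransmissionDefect.X D) (Uε : ℝ → TransmissionDefect.X D),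
      U = (TransmissionDefect.op D (TransmissionDefect.constCoeff A) γ).inverse F →
      (∀ ε : ℝ, 0 < ε → Uε ε = (TransmissionDefect.op D
        (TransmissionDefect.defectCoeff A Am z B hBmeas ε) γ).inverse F) →
      (∃ W : EuclideanSpace ℝ (Fin d) → ℂ, ContDiffOn ℝ ∞ W D ∧
        (TransmissionDefect.fn D (TransmissionDefect.wPart D U) : EuclideanSpace ℝ (Fin d) → ℂ)
          =ᵐ[volume.restrict (D : Set (EuclideanSpace ℝ (Fin d)))] W) →
      (fun ε : ℝ =>
          ‖TransmissionDefect.wPart D (Uε ε) - TransmissionDefect.wPart D U‖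
            + ‖TransmissionDefect.vPart D (Uε ε) - TransmissionDefect.vPart D U‖)
        =O[𝓝[>] 0] fun ε : ℝ => ε ^ ((d : ℝ) / 2) := by
  have hγ_gap : (1 < γ ∧ ∀ a ∈ insert A (Set.range Am), 1 < TransmissionDefect.quadMin a) ∨
      (γ ∈ Set.Ioo 0 1 ∧ ∀ a ∈ insert A (Set.range Am),
        a.IsSymm ∧ 0 < TransmissionDefect.quadMin a ∧ TransmissionDefect.quadMax a < 1) := by
    simp only [Set.forall_mem_insert, Set.forall_mem_range]
    rcases hγ with ⟨hA1, hAm1, rfl⟩ | ⟨hA0, hAm0, hA1, hAm1, rfl⟩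
    · exact .inl ⟨hA1, hA1, hAm1⟩
    · exact .inr ⟨⟨hA0.trans_le (TransmissionDefect.quadMin_le_quadMax A), hA1⟩,
        ⟨hA, hA0, hA1⟩, fun m => ⟨hAm m, hAm0 m, hAm1 m⟩⟩
  obtain ⟨hconst, hdefect, herror⟩ := mainTheorem11_general D A Am hz hBmeas hBbdd hγ_gap
  exact ⟨hconst, fun ε _ => hdefect ε, fun F U Uε hU hUε ⟨W, hW, hwW⟩ => herror F U Uε hU hUε
    fun m => TransmissionDefect.grad_isBigO_one_nhds (hW.of_le (by simp)) hwW (hzD m)⟩
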